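/- Rings are additive abelian groups with a bi-additive multiplication and an identity element $1\neq 0$; multiplication is not assumed associative, and ideals are two-sided. For such a ring $T$, let $N(T)$ be its nucleus, i.e. the associative unital subring of all $r\in T$ such that $(rs)t=r(st)$, $(sr)t=s(rt)$ and $(st)r=s(tr)$ for all $s,t\in T$, and let $N(T)^\times$ be the group of units of $N(T)$ (equivalently, the elements of $N(T)$ that have a two-sided inverse in $T$). Let $Z(T)$ be the centre of $T$, i.e. the set of all $r\in N(T)$ with $rs=sr$ for all $s\in T$. A non-associative crossed system $(T,G,\sigma,\alpha)$ consists of such a ring $T$, a group $G$ with identity $e$, and maps $\sigma\colon G\to\mathrm{Aut}(T)$ and $\alpha\colon G\times G\to N(T)^\times$ such that for all $g,h,s\in G$ and $a\in T$: (N1) $\sigma_g(\sigma_h(a))=\alpha(g,h)\,\sigma_{gh}(a)\,\alpha(g,h)^{-1}$; (N2) $\alpha(g,h)\,\alpha(gh,s)=\sigma_g(\alpha(h,s))\,\alpha(g,hs)$; (N3) $\sigma_e=\mathrm{id}_T$ and $\alpha(g,e)=\alpha(e,g)=1$. The associated non-associative crossed product $T\rtimes_\sigma^\alpha G$ is the set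 of finite formal sums $\sum_{g\in G}t_gu_g$ $(t_g\in T)$ with coordinatewise addition and with the bi-additive multiplication determined by $(a u_g)(b u_h)=a\,\sigma_g(b)\,\alpha(g,h)\,u_{gh}$ for $a,b\in T$ and $g,h\in G$; $T$ is identified with $Tu_e$. The ring $T$ is called $G$-simple if $\{0\}$ and $T$ are the only ideals $I$ of $T$ with $\sigma_g(I)\subseteq I$ for all $g\in G$. Put $Z(T)^G=\{t\in Z(T)\mid \sigma_g(t)=t \text{ for all } g\in G\}$. A group is hypercentral if each of its non-trivial factor groups has a non-trivial centre; $Z(G)$ denotes the centre of $G$. **Theorem.** Let $T\rtimes_\sigma^\alpha G$ be a non-associative crossed product, where $G$ is a torsion-free hypercentral group. Then the following three conditions are equivalent: (i) $T\rtimes_\sigma^\alpha G$ is simple; (ii) $T$ is $G$-simple and $Z(T\rtimes_\sigma^\alpha G)=Z(T)^G$; (iii) $T$ is $G$-simple and there do not exist $u\in N(T)^\times$ and $g\in Z(G)\setminus\{e\}$ such that for every $h\in G$ and every $t\in T$ the relations $\sigma_h(u)=u\,\alpha(g,h)\,\alpha(h,g)^{-1}$ and $\sigma_g(t)=u^{-1}tu$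 hold. -/

import Mathlib

/-- The nucleus `N(T)` of a not necessarily associative unital ring `T`: the elements that
associate with all others in the left, middle and right position. -/
def nonassocNucleus (T : Type*) [NonAssocRing T] : Subring T where
  carrier := {r | (∀ s t : T, r * s * t = r * (s * t)) ∧
    (∀ s t : T, s * r * t = s * (r * t)) ∧ (∀ s t : T, s * t * r = s * (t * r))}
  mul_mem' := by
    rintro a b ⟨ha1, ha2, ha3⟩ ⟨hb1, hb2, hb3⟩
    refine ⟨fun s t => ?_, fun s t => ?_, fun s t => ?_⟩
    · rw [ha1, ha1, ha1, hb1]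
    · rw [← hb3, hb2, ha2, ha1]
    · rw [← hb3, ha3, hb3, hb3]
  one_mem' := by simp
  add_mem' := by
    rintro a b ⟨ha1, ha2, ha3⟩ ⟨hb1, hb2, hb3⟩
    refine ⟨fun s t => ?_, fun s t => ?_, fun s t => ?_⟩
    · simp only [add_mul, ha1, hb1]
    · simp only [add_mul, mul_add, ha2, hb2]
    · simp only [mul_add, ha3, hb3]
  zero_mem' := by simp
  neg_mem' := by
    rintro a ⟨ha1, ha2, ha3⟩
    refine ⟨fun s t => ?_, fun s t => ?_, fun s t => ?_⟩
    · simp only [neg_mul, ha1]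
    · simp only [neg_mul, mul_neg, ha2]
    · simp only [mul_neg, ha3]

/-- The nucleus is an associative unital ring (with the operations of `T`), so that its group of
units `(nonassocNucleus T)ˣ` makes sense. -/
instance nonassocNucleusRing (T : Type*) [NonAssocRing T] : Ring (nonassocNucleus T) :=
  { (inferInstance : NonAssocRing (nonassocNucleus T)) with
    mul_assoc := fun a b c => Subtype.ext (a.2.1 b c) }

/-- A non-associative crossed system `(T, G, σ, α)`: maps `σ : G → Aut(T)` and
`α : G × G → N(T)ˣ` subject to the three conditions (N1), (N2), (N3) below. -/
structure NonassocCrossedSystem (T G : Type*) [NonAssocRing T] [Group G] where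
  /-- the map `σ : G → Aut(T)` -/
  σ : G → (T ≃+* T)
  /-- the map `α : G × G → N(T)ˣ` -/
  α : G → G → (nonassocNucleus T)ˣ
  twisted_action : ∀ (g h : G) (a : T),
    σ g (σ h a) = ((α g h : nonassocNucleus T) : T) * σ (g * h) a *
      (((α g h)⁻¹ : (nonassocNucleus T)ˣ) : nonassocNucleus T)
  cocycle : ∀ g h s : G,
    ((α g h : nonassocNucleus T) : T) * ((α (g * h) s : nonassocNucleus T) : T) =
      σ g ((α h s : nonassocNucleus T) : T) * ((α g (h * s) : nonassocNucleus T) : T)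
  σ_one : σ 1 = RingEquiv.refl T
  α_one_right : ∀ g : G, α g 1 = 1
  α_one_left : ∀ g : G, α 1 g = 1

namespace NonassocCrossedSystem

variable {T G : Type*} [NonAssocRing T] [Group G]

/-- The biadditive extension of `(a u_g) (b u_h) = a σ_g(b) α(g,h) u_{gh}` to finite formal sums
`∑ t_g u_g`, encoded by the finitely supported functions `g ↦ t_g`. -/
noncomputable def mulFun (S : NonassocCrossedSystem T G) (x y : G →₀ T) : G →₀ T :=
  x.sum fun g a => y.sum fun h b =>
    Finsupp.single (g * h) (a * S.σ g b * ((S.α g h : nonassocNucleus T) : T))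

theorem mulFun_single_single (S : NonassocCrossedSystem T G) (g h : G) (a b : T) :
    S.mulFun (Finsupp.single g a) (Finsupp.single h b) =
      Finsupp.single (g * h) (a * S.σ g b * ((S.α g h : nonassocNucleus T) : T)) := by
  unfold mulFun
  rw [Finsupp.sum_single_index, Finsupp.sum_single_index]
  · simp
  · simp

theorem mulFun_add (S : NonassocCrossedSystem T G) (x y z : G →₀ T) :
    S.mulFun x (y + z) = S.mulFun x y + S.mulFun x z := by
  unfold mulFun
  rw [← Finsupp.sum_add]
  refine Finsupp.sum_congr fun g _ => ?_
  refine Finsupp.sum_add_index' (fun h => ?_) (fun h b c => ?_)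
  · simp
  · simp [mul_add, add_mul]

theorem add_mulFun (S : NonassocCrossedSystem T G) (x y z : G →₀ T) :
    S.mulFun (x + y) z = S.mulFun x z + S.mulFun y z := by
  unfold mulFun
  refine Finsupp.sum_add_index' (fun h => ?_) (fun h b c => ?_)
  · simp
  · simp [add_mul, Finsupp.sum_add]

theorem one_mulFun (S : NonassocCrossedSystem T G) (x : G →₀ T) :
    S.mulFun (Finsupp.single 1 1) x = x := by
  unfold mulFun
  rw [Finsupp.sum_single_index]
  · simp [S.σ_one, S.α_one_left]
  · simp

theorem mulFun_one (S : NonassocCrossedSystem T G) (x : G →₀ T) :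
    S.mulFun x (Finsupp.single 1 1) = x := by
  unfold mulFun
  have h : ∀ (g : G) (a : T), ((Finsupp.single (1 : G) (1 : T)).sum fun h b =>
      Finsupp.single (g * h) (a * S.σ g b * ((S.α g h : nonassocNucleus T) : T))) =
        Finsupp.single g a := by
    intro g a
    rw [Finsupp.sum_single_index]
    · simp [S.α_one_right]
    · simp
  simp only [h]
  exact Finsupp.sum_single x

/-- The crossed product `T ⋊_σ^α G`: the finite formal sums `∑ t_g u_g` with coordinatewise
addition and the multiplication `mulFun`. -/
def Product (_S : NonassocCrossedSystem T G) : Type _ := G →₀ T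

noncomputable instance (S : NonassocCrossedSystem T G) : AddCommGroup S.Product :=
  inferInstanceAs (AddCommGroup (G →₀ T))

noncomputable instance (S : NonassocCrossedSystem T G) : NonAssocRing S.Product :=
  { (inferInstance : AddCommGroup S.Product) with
    mul := S.mulFun
    one := Finsupp.single (1 : G) (1 : T)
    left_distrib := S.mulFun_add
    right_distrib := S.add_mulFun
    zero_mul := fun x => by
      change S.mulFun 0 x = 0
      simp [mulFun]
    mul_zero := fun x => by
      change S.mulFun x 0 = 0
      simp [mulFun, Finsupp.sum]
    one_mul := S.one_mulFun
    mul_one := S.mulFun_one }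

/-- The identification of `t ∈ T` with the element `t u_e` of the crossed product. -/
noncomputable def base (S : NonassocCrossedSystem T G) (t : T) : S.Product :=
  (Finsupp.single 1 t : G →₀ T)

/-- A (two-sided) ideal `I` of `T` is `G`-invariant if `σ_g(I) ⊆ I` for all `g`. -/
def IsInvariant (S : NonassocCrossedSystem T G) (I : TwoSidedIdeal T) : Prop :=
  ∀ g : G, ∀ t ∈ I, S.σ g t ∈ I

/-- `T` is `G`-simple if its only `G`-invariant ideals are `{0}` and `T`. -/
def IsGSimple (S : NonassocCrossedSystem T G) : Prop :=
  ∀ I : TwoSidedIdeal T, S.IsInvariant I → I = ⊥ ∨ I = ⊤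

/-- `Z(T)^G`, the set of central elements of `T` that are fixed by all `σ_g`; the centre
`Set.center T` consists of the elements that commute and associate with all others. -/
def fixedCenter (S : NonassocCrossedSystem T G) : Set T :=
  {t | t ∈ Set.center T ∧ ∀ g : G, S.σ g t = t}

end NonassocCrossedSystem

/-- A group is hypercentral if each of its non-trivial factor groups has a non-trivial centre. -/
def IsHypercentralGroup (G : Type*) [Group G] : Prop :=
  ∀ (N : Subgroup G) [N.Normal], Nontrivial (G ⧸ N) → Nontrivial (Subgroup.center (G ⧸ N))

/-- A group is torsion-free if only its identity element has finite order. -/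
def IsTorsionFreeGroup (G : Type*) [Group G] : Prop :=
  ∀ g : G, IsOfFinOrder g → g = 1

/-! The implications run (i) → (iii) → (ii) → (i).

(i) → (iii): the elements with all coefficients in a `G`-invariant ideal of `T` form an ideal of the
crossed product. A pair `(u, g)` as in (iii) makes `u u_g` central. Then `1 + u u_g` is a nonzero
central element of a simple ring, hence invertible. But its inverse would be a geometric series
along the powers of `g`, which cannot have finite support since `g` has infinite order.

(iii) → (ii): the support of a central element is finite and closed under conjugation. In a
torsion-free hypercentral group this forces it into `Z(G)` (`finiteConjSubgroup_le_center`). A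
nonzero coefficient `a` at `g` generates the invariant ideal `T a`, so `a` is a unit, and `g ≠ e`
would give a forbidden pair.

(ii) → (i): by `normal_induction`, every nonzero conjugation-invariant ideal in degrees `N` contains
`1`, for `N` growing from trivial to `G`. For `M/N` central (`one_mem_of_central_extension`), take
elements of the ideal meeting as few cosets of `N` as possible. They are determined by their part in
`N`, so the one whose part is `1` is central, hence lies in `T` and equals `1`. -/

/-- Induction along central extensions in a hypercentral group. -/
theorem IsHypercentralGroup.normal_induction {G : Type*} [Group G] (hG : IsHypercentralGroup G)
    (P : Subgroup G → Prop) (bot : P ⊥)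
    (sup : ∀ c : Set (Subgroup G), c.Nonempty → IsChain (· ≤ ·) c →
      (∀ N ∈ c, N.Normal ∧ P N) → P (sSup c))
    (step : ∀ N M : Subgroup G, N.Normal → M.Normal → N ≤ M →
      (∀ m ∈ M, ∀ g : G, g * m * g⁻¹ * m⁻¹ ∈ N) → P N → P M) : P ⊤ := by
  -- A maximal normal subgroup with `P` is all of `G`: otherwise the preimage of the nontrivial
  -- centre of `G ⧸ N` is strictly larger, and `step` applies to it.
  obtain ⟨N, -, hN⟩ := zorn_le_nonempty₀ {N : Subgroup G | N.Normal ∧ P N}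
    (fun c hc hchain N hN => by
      refine ⟨sSup c, ⟨?_, sup c ⟨N, hN⟩ hchain fun M hM => hc hM⟩, fun M hM => le_sSup hM⟩
      refine ⟨fun n hn g => ?_⟩
      rw [Subgroup.mem_sSup_of_directedOn ⟨N, hN⟩ hchain.directedOn] at hn ⊢
      obtain ⟨M, hM, hn⟩ := hn
      exact ⟨M, hM, (hc hM).1.conj_mem n hn g⟩) ⊥ ⟨inferInstance, bot⟩
  obtain ⟨hNn, hPN⟩ := hN.prop
  by_cases hT : N = ⊤
  · exact hT ▸ hPN
  have hnt : Nontrivial (G ⧸ N) := by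
    by_contra h
    rw [not_nontrivial_iff_subsingleton] at h
    exact hT (QuotientGroup.subgroup_eq_top_of_subsingleton N h)
  obtain ⟨z, hz⟩ := @exists_ne _ (hG N hnt) 1
  set M := (Subgroup.center (G ⧸ N)).comap (QuotientGroup.mk' N) with hM
  have hNM : N ≤ M := fun n hn => by
    have : QuotientGroup.mk' N n = 1 := (QuotientGroup.eq_one_iff n).2 hn
    rw [hM, Subgroup.mem_comap, this]
    exact one_mem _
  have hMn : M.Normal := inferInstance
  have hPM : P M := step N M hNn hMn hNM (fun m hm g => by
    rw [← QuotientGroup.eq_one_iff]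
    have := Subgroup.mem_center_iff.1 hm (g : G ⧸ N)
    simp only [QuotientGroup.mk'_apply] at this
    simp only [QuotientGroup.mk_mul, QuotientGroup.mk_inv, this]
    group) hPN
  have hMN : M ≤ N := hN.le_of_ge ⟨hMn, hPM⟩ hNM
  obtain ⟨⟨z, hzc⟩, rfl⟩ : ∃ w, w = z := ⟨z, rfl⟩
  obtain ⟨m, rfl⟩ := QuotientGroup.mk_surjective z
  have hm : m ∈ M := hzc
  exact absurd (Subtype.ext ((QuotientGroup.eq_one_iff m).2 (hMN hm))) hz

/-- A normal subgroup of a hypercentral group not contained in a subgroup `B` has an element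
outside of `B` that is central modulo `B`. -/
theorem IsHypercentralGroup.exists_mem_commutator_mem {G : Type*} [Group G]
    (hG : IsHypercentralGroup G) (A B : Subgroup G) [hA : A.Normal] (hAB : ¬ A ≤ B) :
    ∃ h ∈ A, h ∉ B ∧ ∀ g : G, g * h * g⁻¹ * h⁻¹ ∈ B := by
  by_contra! H
  refine hAB ?_
  -- If no such element exists, anything in `A` that is central modulo `N` is central modulo `B` as
  -- soon as `N ⊓ A ≤ B`, hence lies in `B`; so the inclusion climbs to `N = ⊤`.
  have := hG.normal_induction (fun N => N ⊓ A ≤ B) (by simp) ?_ ?_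
  · simpa using this
  · rintro c hne hchain hc x ⟨hx, hxA⟩
    obtain ⟨M, hM, hx⟩ := (Subgroup.mem_sSup_of_directedOn hne hchain.directedOn).1 hx
    exact (hc M hM).2 ⟨hx, hxA⟩
  · rintro N M hN hM hNM hcomm hPN x ⟨hx, hxA⟩
    by_contra hxB
    obtain ⟨g, hg⟩ := H x hxA hxB
    exact hg (hPN ⟨hcomm x hx g, A.mul_mem (hA.conj_mem x hxA g) (A.inv_mem hxA)⟩)

/-- The normal subgroup of the elements with finitely many conjugates. -/
def finiteConjSubgroup (G : Type*) [Group G] : Subgroup G where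
  carrier := {x | (Set.range fun g : G => g * x * g⁻¹).Finite}
  mul_mem' := by
    intro a b ha hb
    refine (Set.Finite.mul ha hb).subset ?_
    rintro _ ⟨g, rfl⟩
    exact ⟨_, ⟨g, rfl⟩, _, ⟨g, rfl⟩, by simp [mul_assoc]⟩
  one_mem' := by simp
  inv_mem' := by
    intro a ha
    refine (Set.Finite.inv ha).subset ?_
    rintro _ ⟨g, rfl⟩
    exact ⟨g, by simp [mul_assoc]⟩

instance finiteConjSubgroup_normal (G : Type*) [Group G] : (finiteConjSubgroup G).Normal where
  conj_mem := by
    intro x hx k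
    refine Set.Finite.subset hx ?_
    rintro _ ⟨g, rfl⟩
    exact ⟨g * k, by simp [mul_assoc]⟩

/-- In a torsion-free hypercentral group, elements with finitely many conjugates are central. -/
theorem IsHypercentralGroup.finiteConjSubgroup_le_center {G : Type*} [Group G]
    (hG : IsHypercentralGroup G) (hG' : IsTorsionFreeGroup G) :
    finiteConjSubgroup G ≤ Subgroup.center G := by
  by_contra H
  obtain ⟨h, hfin, hnc, hcomm⟩ := hG.exists_mem_commutator_mem _ _ H
  refine hnc (Subgroup.mem_center_iff.2 fun g => ?_)
  set z := g * h * g⁻¹ * h⁻¹ with hz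
  have hzc := Subgroup.mem_center_iff.1 (hcomm g)
  have hzh : g * h * g⁻¹ = z * h := by simp [hz]
  -- As `z` is central, conjugation by powers of `g` multiplies `h` by powers of `z`. Finitely many
  -- conjugates make `z` torsion, hence trivial.
  have hpow : ∀ n : ℕ, g ^ n * h * (g ^ n)⁻¹ = z ^ n * h := by
    intro n
    induction n with
    | zero => simp
    | succ n ih =>
      have hzn : g * z ^ n = z ^ n * g := (Commute.pow_right (hzc g) n)
      calc g ^ (n + 1) * h * (g ^ (n + 1))⁻¹
          = g * (g ^ n * h * (g ^ n)⁻¹) * g⁻¹ := by rw [pow_succ']; group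
        _ = (g * z ^ n) * h * g⁻¹ := by rw [ih]; group
        _ = z ^ n * (g * h * g⁻¹) := by rw [hzn]; group
        _ = z ^ (n + 1) * h := by rw [hzh]; group
  have hz1 : z = 1 := by
    refine hG' z ?_
    by_contra hinf
    have hinj : Function.Injective fun n : ℕ => z ^ n :=
      injective_pow_iff_not_isOfFinOrder.2 hinf
    refine Set.infinite_range_of_injective (f := fun n : ℕ => z ^ n * h)
      (fun a b hab => hinj (mul_right_cancel hab)) (Set.Finite.subset hfin ?_)
    rintro _ ⟨n, rfl⟩
    exact ⟨g ^ n, hpow n⟩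
  rw [hz1, one_mul] at hzh
  exact mul_inv_eq_iff_eq_mul.1 hzh

/-! ### The nucleus under automorphisms and inversion. -/

theorem map_mem_nonassocNucleus {T : Type*} [NonAssocRing T] (f : T ≃+* T) {r : T}
    (hr : r ∈ nonassocNucleus T) : f r ∈ nonassocNucleus T := by
  obtain ⟨h1, h2, h3⟩ := hr
  refine ⟨fun s t => ?_, fun s t => ?_, fun s t => ?_⟩ <;>
    obtain ⟨s, rfl⟩ := f.surjective s <;> obtain ⟨t, rfl⟩ := f.surjective t <;>
    simp only [← map_mul, h1, h2, h3]

/-- A two-sided inverse of an element of the nucleus lies in the nucleus. -/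
theorem inverse_mem_nonassocNucleus {T : Type*} [NonAssocRing T] {a b : T}
    (ha : a ∈ nonassocNucleus T) (hab : a * b = 1) (hba : b * a = 1) :
    b ∈ nonassocNucleus T := by
  obtain ⟨h1, h2, h3⟩ := ha
  have L : ∀ x, a * (b * x) = x := fun x => by rw [← h1, hab, one_mul]
  have R : ∀ x, x * b * a = x := fun x => by rw [h3, hba, mul_one]
  have injL : ∀ {x y}, a * x = a * y → x = y := fun {x y} h => by
    have hc : ∀ x, b * (a * x) = x := fun x => by rw [← h2, hba, one_mul]
    rw [← hc x, h, hc]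
  have injR : ∀ {x y}, x * a = y * a → x = y := fun {x y} h => by
    have hc : ∀ x, x * a * b = x := fun x => by rw [h2, hab, mul_one]
    rw [← hc x, h, hc]
  refine ⟨fun s t => ?_, fun s t => ?_, fun s t => ?_⟩
  · exact injL (by rw [← h1, L, L])
  · have : s * b * (a * (b * t)) = s * b * a * (b * t) := (h2 _ _).symm
    rwa [L, R] at this
  · exact injR (by rw [R, h3, R])

/-! ### Cocycle identities and coefficient calculus in the crossed product. -/

namespace NonassocCrossedSystem

variable {T G : Type*} [NonAssocRing T] [Group G] (S : NonassocCrossedSystem T G)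

/-- The value of the cocycle as an element of `T`. -/
def cocycleVal (g h : G) : T := ((S.α g h : nonassocNucleus T) : T)

/-- The inverse of the value of the cocycle as an element of `T`. -/
def cocycleInv (g h : G) : T := (((S.α g h)⁻¹ : (nonassocNucleus T)ˣ) : nonassocNucleus T)

theorem cocycleVal_mem (g h : G) : S.cocycleVal g h ∈ nonassocNucleus T := Subtype.prop _

theorem cocycleInv_mem (g h : G) : S.cocycleInv g h ∈ nonassocNucleus T := Subtype.prop _

theorem cocycleVal_mul_inv (g h : G) : S.cocycleVal g h * S.cocycleInv g h = 1 :=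
  congrArg Subtype.val (S.α g h).mul_inv

theorem cocycleInv_mul_val (g h : G) : S.cocycleInv g h * S.cocycleVal g h = 1 :=
  congrArg Subtype.val (S.α g h).inv_mul

@[simp]
theorem mul_cocycleVal_mul_inv (g h : G) (x : T) :
    x * S.cocycleVal g h * S.cocycleInv g h = x := by
  rw [(S.cocycleInv_mem g h).2.2, S.cocycleVal_mul_inv, mul_one]

@[simp]
theorem mul_cocycleInv_mul_val (g h : G) (x : T) :
    x * S.cocycleInv g h * S.cocycleVal g h = x := by
  rw [(S.cocycleVal_mem g h).2.2, S.cocycleInv_mul_val, mul_one]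

theorem mul_cocycleVal_inj {g h : G} {x y : T} :
    x * S.cocycleVal g h = y * S.cocycleVal g h ↔ x = y :=
  ⟨fun H => by rw [← S.mul_cocycleVal_mul_inv g h x, H, S.mul_cocycleVal_mul_inv],
    fun H => by rw [H]⟩

theorem mul_cocycleVal_eq_zero {g h : G} {x : T} : x * S.cocycleVal g h = 0 ↔ x = 0 := by
  conv_lhs => rw [← zero_mul (S.cocycleVal g h)]
  exact S.mul_cocycleVal_inj

@[simp]
theorem cocycleVal_one_right (g : G) : S.cocycleVal g 1 = 1 := by
  simp [cocycleVal, S.α_one_right]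

@[simp]
theorem cocycleVal_one_left (g : G) : S.cocycleVal 1 g = 1 := by
  simp [cocycleVal, S.α_one_left]

@[simp]
theorem σ_one_apply (t : T) : S.σ 1 t = t := by simp [S.σ_one]

theorem σ_σ_mul_cocycleVal (g h : G) (a : T) :
    S.σ g (S.σ h a) * S.cocycleVal g h = S.cocycleVal g h * S.σ (g * h) a := by
  have : S.σ g (S.σ h a) = S.cocycleVal g h * S.σ (g * h) a * S.cocycleInv g h :=
    S.twisted_action g h a
  rw [this, mul_cocycleInv_mul_val]

theorem cocycleVal_mul_cocycleVal (g h k : G) :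
    S.cocycleVal g h * S.cocycleVal (g * h) k =
      S.σ g (S.cocycleVal h k) * S.cocycleVal g (h * k) := S.cocycle g h k

/-- The twisted associativity that makes the homogeneous elements `u_h` nuclear. -/
theorem σ_mul_cocycleVal_mul (g h k : G) (a : T) :
    S.σ g (S.σ h a * S.cocycleVal h k) * S.cocycleVal g (h * k) =
      S.cocycleVal g h * S.σ (g * h) a * S.cocycleVal (g * h) k := by
  rw [map_mul, (S.cocycleVal_mem g (h * k)).2.2, ← S.cocycleVal_mul_cocycleVal,
    ← (S.cocycleVal_mem g h).2.1, S.σ_σ_mul_cocycleVal]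

/-- The homogeneous element `a u_g`. -/
noncomputable def hom (g : G) (a : T) : S.Product := (Finsupp.single g a : G →₀ T)

/-- The coefficient of `u_g`. -/
def coeff (g : G) : S.Product →+ T := Finsupp.applyAddHom (M := T) g

/-- The set of degrees with non-zero coefficient. -/
def supp (x : S.Product) : Finset G := Finsupp.support (M := T) x

variable {S}

theorem mem_supp {x : S.Product} {g : G} : g ∈ S.supp x ↔ S.coeff g x ≠ 0 :=
  Finsupp.mem_support_iff (M := T)

theorem ext_coeff {x y : S.Product} (h : ∀ g, S.coeff g x = S.coeff g y) : x = y :=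
  Finsupp.ext (M := T) h

theorem base_eq_hom (t : T) : S.base t = S.hom 1 t := rfl

theorem one_eq_hom : (1 : S.Product) = S.hom 1 1 := rfl

open Classical in
theorem coeff_hom (g h : G) (a : T) : S.coeff h (S.hom g a) = if g = h then a else 0 :=
  Finsupp.single_apply (M := T)

@[simp]
theorem coeff_hom_same (g : G) (a : T) : S.coeff g (S.hom g a) = a := by
  simp [coeff_hom]

theorem coeff_hom_of_ne {g h : G} (hgh : g ≠ h) (a : T) : S.coeff h (S.hom g a) = 0 := by
  simp [coeff_hom, hgh]

theorem hom_mul_hom (g h : G) (a b : T) :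
    S.hom g a * S.hom h b = S.hom (g * h) (a * S.σ g b * S.cocycleVal g h) :=
  S.mulFun_single_single g h a b

theorem hom_add (g : G) (a b : T) : S.hom g (a + b) = S.hom g a + S.hom g b :=
  Finsupp.single_add (M := T) g a b

@[simp]
theorem hom_zero (g : G) : S.hom g 0 = 0 := Finsupp.single_zero (M := T) g

theorem hom_induction {P : S.Product → Prop} (x : S.Product) (zero : P 0)
    (add : ∀ x y, P x → P y → P (x + y)) (hom : ∀ g a, P (S.hom g a)) : P x :=
  Finsupp.induction_linear (M := T) (motive := P) x zero add hom

theorem base_mul_base (s t : T) : S.base s * S.base t = S.base (s * t) := by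
  simp [base_eq_hom, hom_mul_hom]

theorem coeff_hom_mul (g k : G) (a : T) (y : S.Product) :
    S.coeff k (S.hom g a * y) = a * S.σ g (S.coeff (g⁻¹ * k) y) * S.cocycleVal g (g⁻¹ * k) := by
  induction y using hom_induction with
  | zero => simp
  | add x y hx hy => simp only [mul_add, map_add, hx, hy, add_mul]
  | hom h b =>
    rw [hom_mul_hom]
    by_cases hk : g * h = k
    · subst hk
      simp
    · rw [coeff_hom_of_ne hk, coeff_hom_of_ne (fun H => hk (by rw [H]; group))]
      simp

theorem coeff_mul_hom (h k : G) (b : T) (x : S.Product) :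
    S.coeff k (x * S.hom h b) =
      S.coeff (k * h⁻¹) x * S.σ (k * h⁻¹) b * S.cocycleVal (k * h⁻¹) h := by
  induction x using hom_induction with
  | zero => simp
  | add x y hx hy => simp only [map_add, hx, hy, add_mul]
  | hom g a =>
    rw [hom_mul_hom]
    by_cases hk : g * h = k
    · subst hk
      simp
    · rw [coeff_hom_of_ne hk, coeff_hom_of_ne (fun H => hk (by rw [H]; group))]
      simp

theorem coeff_base_mul (k : G) (t : T) (x : S.Product) :
    S.coeff k (S.base t * x) = t * S.coeff k x := by
  simp [base_eq_hom, coeff_hom_mul]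

theorem coeff_mul_base (k : G) (t : T) (x : S.Product) :
    S.coeff k (x * S.base t) = S.coeff k x * S.σ k t := by
  simp [base_eq_hom, coeff_mul_hom]

/-- By biadditivity only homogeneous factors matter, and there the cocycle identities decide. With
the next two lemmas this puts `u_h` in the nucleus of the crossed product, so failure of
associativity comes only from `T`. -/
theorem hom_one_mul_assoc (h : G) (x y : S.Product) :
    S.hom h 1 * x * y = S.hom h 1 * (x * y) := by
  induction x using hom_induction with
  | zero => simp
  | add x x' hx hy => simp only [mul_add, add_mul, hx, hy]
  | hom g a =>
  induction y using hom_induction with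
  | zero => simp
  | add x x' hx hy => simp only [mul_add, hx, hy]
  | hom k b =>
    simp only [hom_mul_hom, one_mul, ← mul_assoc h g k]
    congr 1
    rw [(S.cocycleVal_mem g k).2.2, map_mul, (S.cocycleVal_mem h (g * k)).2.2,
      S.σ_mul_cocycleVal_mul, (S.cocycleVal_mem h g).2.1,
      (S.cocycleVal_mem (h * g) k).2.2]

theorem mul_hom_one_assoc (h : G) (x y : S.Product) :
    x * S.hom h 1 * y = x * (S.hom h 1 * y) := by
  induction x using hom_induction with
  | zero => simp
  | add x x' hx hy => simp only [add_mul, hx, hy]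
  | hom g a =>
  induction y using hom_induction with
  | zero => simp
  | add x x' hx hy => simp only [mul_add, hx, hy]
  | hom k b =>
    simp only [hom_mul_hom, one_mul, map_one, mul_one, ← mul_assoc g h k]
    congr 1
    rw [(S.cocycleVal_mem g (h * k)).2.2, S.σ_mul_cocycleVal_mul, (S.cocycleVal_mem g h).2.1,
      (S.cocycleVal_mem (g * h) k).2.2]

theorem mul_mul_hom_one (h : G) (x y : S.Product) :
    x * y * S.hom h 1 = x * (y * S.hom h 1) := by
  induction x using hom_induction with
  | zero => simp
  | add x x' hx hy => simp only [add_mul, hx, hy]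
  | hom g a =>
  induction y using hom_induction with
  | zero => simp
  | add x x' hx hy => simp only [mul_add, add_mul, hx, hy]
  | hom k b =>
    simp only [hom_mul_hom, map_one, mul_one, ← mul_assoc g k h]
    congr 1
    rw [map_mul, ← (map_mem_nonassocNucleus (S.σ g) (S.cocycleVal_mem k h)).2.2,
      (S.cocycleVal_mem g (k * h)).2.2, ← S.cocycleVal_mul_cocycleVal,
      ← (S.cocycleVal_mem (g * k) h).2.2]

theorem base_mul_hom_one (g : G) (t : T) : S.base t * S.hom g 1 = S.hom g t := by
  simp [base_eq_hom, hom_mul_hom]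

theorem hom_inv_mul_hom_one (h : G) :
    S.hom h⁻¹ (S.cocycleInv h⁻¹ h) * S.hom h 1 = 1 := by
  simp [hom_mul_hom, one_eq_hom, S.cocycleInv_mul_val]

/-- An element is central as soon as it commutes with `T` and all `u_h` and associates
with `T`. -/
theorem mem_center_of_base {y : S.Product} (hT : ∀ t, y * S.base t = S.base t * y)
    (hu : ∀ h, y * S.hom h 1 = S.hom h 1 * y)
    (hl : ∀ s t, y * (S.base s * S.base t) = y * S.base s * S.base t)
    (hr : ∀ s t, S.base s * S.base t * y = S.base s * (S.base t * y)) :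
    y ∈ Set.center S.Product := by
  have key : ∀ (g h : G) (s t : T), S.hom g s * S.hom h t =
      S.base s * S.base (S.σ g t * S.cocycleVal g h) * S.hom (g * h) 1 := by
    intro g h s t
    rw [hom_mul_hom, base_mul_base, base_mul_hom_one, (S.cocycleVal_mem g h).2.2]
  have key' : ∀ (g h : G) (t : T), S.hom g 1 * S.hom h t =
      S.base (S.σ g t * S.cocycleVal g h) * S.hom (g * h) 1 := by
    intro g h t
    rw [hom_mul_hom, base_mul_hom_one, one_mul]
  refine ⟨fun x => ?_, fun b c => ?_, fun b c => ?_⟩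
  · show y * x = x * y
    induction x using hom_induction with
    | zero => simp
    | add x x' hx hy => simp only [mul_add, add_mul, hx, hy]
    | hom g a =>
      rw [← base_mul_hom_one, ← mul_mul_hom_one, hT, mul_mul_hom_one, hu, mul_hom_one_assoc]
  · induction b using hom_induction with
    | zero => simp
    | add x x' hx hy => simp only [mul_add, add_mul, hx, hy]
    | hom g s =>
    induction c using hom_induction with
    | zero => simp
    | add x x' hx hy => simp only [mul_add, hx, hy]
    | hom h t =>
      rw [key, ← mul_mul_hom_one, hl, ← base_mul_hom_one g s, ← mul_mul_hom_one g y,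
        mul_hom_one_assoc, key', mul_mul_hom_one]
  · induction b using hom_induction with
    | zero => simp
    | add x x' hx hy => simp only [add_mul, hx, hy]
    | hom g s =>
    induction c using hom_induction with
    | zero => simp
    | add x x' hx hy => simp only [mul_add, add_mul, hx, hy]
    | hom h t =>
      rw [key, mul_hom_one_assoc, ← hu, ← mul_mul_hom_one, hr, ← base_mul_hom_one g s,
        mul_hom_one_assoc, ← hom_one_mul_assoc, key', mul_hom_one_assoc, ← hu, ← mul_mul_hom_one,
        ← mul_mul_hom_one]

end NonassocCrossedSystem

/-! ### The centre of the crossed product. -/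

namespace NonassocCrossedSystem

variable {T G : Type*} [NonAssocRing T] [Group G] {S : NonassocCrossedSystem T G}

/-- A homogeneous element of central degree is central if its coefficient is nuclear and
satisfies the commutation relations with `T` and with the elements `u_h`. -/
theorem hom_mem_center {g : G} (hg : g ∈ Subgroup.center G) {a : T}
    (ha : a ∈ nonassocNucleus T) (hT : ∀ t, a * S.σ g t = t * a)
    (hu : ∀ h, S.σ h a * S.cocycleVal h g = a * S.cocycleVal g h) :
    S.hom g a ∈ Set.center S.Product := by
  refine mem_center_of_base (fun t => ?_) (fun h => ?_) (fun s t => ?_) (fun s t => ?_)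
  · simp [base_eq_hom, hom_mul_hom, hT]
  · simp [hom_mul_hom, hu, Subgroup.mem_center_iff.1 hg h]
  · simp [base_eq_hom, hom_mul_hom, ha.1]
  · simp [base_eq_hom, hom_mul_hom, ha.2.2]

theorem base_mem_center {t : T} (ht : t ∈ S.fixedCenter) : S.base t ∈ Set.center S.Product := by
  obtain ⟨⟨hc, hl, hr⟩, hfix⟩ := ht
  refine hom_mem_center (one_mem _) ⟨fun x y => (hl x y).symm, fun x y => ?_, hr⟩ ?_ ?_
  · exact IsMulCentral.mid_assoc ⟨hc, hl, hr⟩ x y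
  · intro x
    simpa using (hc x).eq
  · intro h
    simp [hfix]

/-- Compare coefficients at `g` in the associativity of `z` with elements of `T`; the twist by `σ g`
is absorbed by its surjectivity. -/
theorem coeff_mem_nonassocNucleus {z : S.Product} (hz : z ∈ Set.center S.Product) (g : G) :
    S.coeff g z ∈ nonassocNucleus T := by
  refine ⟨fun s t => ?_, fun s t => ?_, fun s t => ?_⟩
  · obtain ⟨s, rfl⟩ := (S.σ g).surjective s
    obtain ⟨t, rfl⟩ := (S.σ g).surjective t
    have := congrArg (S.coeff g) (hz.left_assoc (S.base s) (S.base t))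
    simpa [base_mul_base, coeff_mul_base] using this.symm
  · obtain ⟨t, rfl⟩ := (S.σ g).surjective t
    have := congrArg (S.coeff g) (hz.mid_assoc (S.base s) (S.base t))
    simpa [base_mul_base, coeff_mul_base, coeff_base_mul] using this
  · have := congrArg (S.coeff g) (hz.right_assoc (S.base s) (S.base t))
    simpa [base_mul_base, coeff_base_mul] using this

theorem coeff_mul_σ_of_mem_center {z : S.Product} (hz : z ∈ Set.center S.Product) (g : G)
    (t : T) : S.coeff g z * S.σ g t = t * S.coeff g z := by
  have := congrArg (S.coeff g) (hz.comm (S.base t)).eq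
  simpa [coeff_mul_base, coeff_base_mul] using this

/-- This is `z u_h = u_h z` read at degree `g * h`. It shows that the coefficients at `g` and at its
conjugates vanish together. -/
theorem σ_coeff_of_mem_center {z : S.Product} (hz : z ∈ Set.center S.Product) (g h : G) :
    S.σ h (S.coeff (h⁻¹ * g * h) z) * S.cocycleVal h (h⁻¹ * g * h) =
      S.coeff g z * S.cocycleVal g h := by
  have := congrArg (S.coeff (g * h)) (hz.comm (S.hom h 1)).eq
  simpa [coeff_mul_hom, coeff_hom_mul, mul_assoc] using this.symm

theorem supp_le_center {z : S.Product} (hG : IsHypercentralGroup G) (hG' : IsTorsionFreeGroup G)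
    (hz : z ∈ Set.center S.Product) {g : G} (hg : S.coeff g z ≠ 0) :
    g ∈ Subgroup.center G := by
  refine hG.finiteConjSubgroup_le_center hG' ?_
  refine (S.supp z).finite_toSet.subset ?_
  rintro _ ⟨h, rfl⟩
  rw [Finset.mem_coe, mem_supp]
  intro H
  have h1 := σ_coeff_of_mem_center hz g h⁻¹
  rw [inv_inv, H, map_zero, zero_mul] at h1
  exact hg (S.mul_cocycleVal_eq_zero.1 h1.symm)

/-- In a `G`-simple ring, a non-zero homogeneous central component is invertible. -/
theorem exists_unit_of_mem_center (hS : S.IsGSimple) {z : S.Product}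
    (hz : z ∈ Set.center S.Product) {g : G} (hg : S.coeff g z ≠ 0)
    (hgc : g ∈ Subgroup.center G) :
    ∃ u : (nonassocNucleus T)ˣ, ((u : nonassocNucleus T) : T) = S.coeff g z := by
  set a := S.coeff g z with ha
  have hn : a ∈ nonassocNucleus T := coeff_mem_nonassocNucleus hz g
  have hT : ∀ t, a * S.σ g t = t * a := coeff_mul_σ_of_mem_center hz g
  have hu : ∀ h, S.σ h a * S.cocycleVal h g = a * S.cocycleVal g h := by
    intro h
    have : h⁻¹ * g * h = g := by
      rw [mul_assoc, ← Subgroup.mem_center_iff.1 hgc h, inv_mul_cancel_left]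
    simpa [this] using σ_coeff_of_mem_center hz g h
  -- The left multiples `T a` are closed under right multiplication because `a` is nuclear and `a
  -- σ_g(y) = y a`.
  let I : TwoSidedIdeal T := TwoSidedIdeal.mk' {x | ∃ t, x = t * a} ⟨0, by simp⟩
    (by rintro _ _ ⟨s, rfl⟩ ⟨t, rfl⟩; exact ⟨s + t, (add_mul _ _ _).symm⟩)
    (by rintro _ ⟨s, rfl⟩; exact ⟨-s, by simp⟩)
    (by rintro x _ ⟨s, rfl⟩; exact ⟨x * s, (hn.2.2 _ _).symm⟩)
    (by
      rintro _ y ⟨s, rfl⟩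
      obtain ⟨y, rfl⟩ := (S.σ g).surjective y
      exact ⟨s * y, by rw [hn.2.1, hT, hn.2.2]⟩)
  have hI : ∀ x, x ∈ I ↔ ∃ t, x = t * a := fun x => by
    simp only [I, TwoSidedIdeal.mem_mk', Set.mem_ofPred_eq]
  have hinv : S.IsInvariant I := by
    intro h x hx
    obtain ⟨t, rfl⟩ := (hI _).1 hx
    -- `σ_h` changes `a` only by a right factor from the nucleus, so `T a` is invariant.
    have h1 : S.σ h a = a * (S.cocycleVal g h * S.cocycleInv h g) := by
      rw [← hn.1, ← hu, S.mul_cocycleVal_mul_inv]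
    rw [map_mul, h1]
    exact I.mul_mem_left _ _ (I.mul_mem_right _ _ ((hI a).2 ⟨1, by simp⟩))
  have hne : I ≠ ⊥ := by
    intro H
    have : a ∈ I := (hI a).2 ⟨1, by simp⟩
    rw [H] at this
    exact hg ((TwoSidedIdeal.mem_bot T).1 this)
  have h1 : (1 : T) ∈ I := by
    rw [(hS I hinv).resolve_left hne]
    trivial
  obtain ⟨b, hb⟩ := (hI 1).1 h1
  -- `b` is a left inverse and `σ_g(b)` a right inverse of the nuclear element `a`, so the two
  -- coincide.
  have hb' : a * S.σ g b = 1 := by rw [hT, ← hb]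
  have hbb : b = S.σ g b := by
    calc b = b * (a * S.σ g b) := by rw [hb', mul_one]
      _ = S.σ g b := by rw [← hn.2.1, ← hb, one_mul]
  rw [← hbb] at hb'
  have hbn := inverse_mem_nonassocNucleus hn hb' hb.symm
  exact ⟨⟨⟨a, hn⟩, ⟨b, hbn⟩, Subtype.ext hb', Subtype.ext hb.symm⟩, rfl⟩

/-- The obstruction to simplicity: a unit `u` of the nucleus and a central `g ≠ 1` for which
`u u_g` is central in the crossed product. -/
def HasCentralUnit (S : NonassocCrossedSystem T G) : Prop :=
  ∃ (u : (nonassocNucleus T)ˣ) (g : G), g ∈ Subgroup.center G ∧ g ≠ 1 ∧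
    ∀ (h : G) (t : T),
      S.σ h ((u : nonassocNucleus T) : T) =
        ((u * S.α g h * (S.α h g)⁻¹ : (nonassocNucleus T)ˣ) : nonassocNucleus T) ∧
      S.σ g t = (((u⁻¹ : (nonassocNucleus T)ˣ) : nonassocNucleus T) : T) * t *
        ((u : nonassocNucleus T) : T)

theorem center_eq_base_image (hG : IsHypercentralGroup G) (hG' : IsTorsionFreeGroup G)
    (hS : S.IsGSimple) (hu : ¬ S.HasCentralUnit) :
    Set.center S.Product = S.base '' S.fixedCenter := by
  refine Set.Subset.antisymm (fun z hz => ?_) ?_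
  swap
  · rintro _ ⟨t, ht, rfl⟩
    exact base_mem_center ht
  have h0 : ∀ g, g ≠ 1 → S.coeff g z = 0 := by
    intro g hg1
    by_contra hg
    have hgc := supp_le_center hG hG' hz hg
    obtain ⟨u, hu'⟩ := exists_unit_of_mem_center hS hz hg hgc
    refine hu ⟨u, g, hgc, hg1, fun h t => ⟨?_, ?_⟩⟩
    · have hh : h⁻¹ * g * h = g := by
        rw [mul_assoc, ← Subgroup.mem_center_iff.1 hgc h, inv_mul_cancel_left]
      have := σ_coeff_of_mem_center hz g h
      rw [hh, ← hu'] at this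
      rw [← S.mul_cocycleVal_mul_inv h g (S.σ h _), this]
      rfl
    · have := coeff_mul_σ_of_mem_center hz g t
      rw [← hu'] at this
      rw [(Subtype.prop (u : nonassocNucleus T)).2.2, ← this,
        ← (Subtype.prop (u : nonassocNucleus T)).2.1]
      have h1 : (((u⁻¹ : (nonassocNucleus T)ˣ) : nonassocNucleus T) : T) *
        ((u : nonassocNucleus T) : T) = 1 := congrArg Subtype.val u.inv_mul
      rw [h1, one_mul]
  have hz1 : z = S.base (S.coeff 1 z) := ext_coeff fun g => by
    by_cases hg : g = 1
    · subst hg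
      simp [base_eq_hom]
    · rw [h0 g hg, base_eq_hom, coeff_hom_of_ne (Ne.symm hg)]
  refine ⟨S.coeff 1 z, ⟨⟨fun t => ?_, fun s t => ?_, fun s t => ?_⟩, fun h => ?_⟩, hz1.symm⟩
  · show _ * _ = _ * _
    simpa using coeff_mul_σ_of_mem_center hz 1 t
  · exact ((coeff_mem_nonassocNucleus hz 1).1 s t).symm
  · exact (coeff_mem_nonassocNucleus hz 1).2.2 s t
  · simpa using σ_coeff_of_mem_center hz 1 h

/-! ### Consequences of simplicity. -/

theorem isGSimple_of_isSimpleRing [IsSimpleRing S.Product] : S.IsGSimple := by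
  intro I hI
  let J : TwoSidedIdeal S.Product := TwoSidedIdeal.mk' {x | ∀ g, S.coeff g x ∈ I}
    (fun g => by simp [I.zero_mem])
    (fun {x y} hx hy g => by rw [map_add]; exact I.add_mem (hx g) (hy g))
    (fun {x} hx g => by rw [map_neg]; exact I.neg_mem (hx g))
    (fun {x y} hy => by
      induction x using hom_induction with
      | zero => simp [I.zero_mem]
      | add x x' hx hx' =>
        intro g
        rw [add_mul, map_add]
        exact I.add_mem (hx g) (hx' g)
      | hom h a =>
        intro g
        rw [coeff_hom_mul]
        exact I.mul_mem_right _ _ (I.mul_mem_left _ _ (hI _ _ (hy _))))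
    (fun {x y} hx => by
      induction y using hom_induction with
      | zero => simp [I.zero_mem]
      | add x x' hx hx' =>
        intro g
        rw [mul_add, map_add]
        exact I.add_mem (hx g) (hx' g)
      | hom h a =>
        intro g
        rw [coeff_mul_hom]
        exact I.mul_mem_right _ _ (I.mul_mem_right _ _ (hx _)))
  have hJ : ∀ x, x ∈ J ↔ ∀ g, S.coeff g x ∈ I := fun x => by
    simp only [J, TwoSidedIdeal.mem_mk', Set.mem_ofPred_eq]
  have hb : ∀ t, t ∈ I ↔ S.base t ∈ J := by
    intro t
    rw [hJ]
    refine ⟨fun ht g => ?_, fun h => by simpa [base_eq_hom] using h 1⟩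
    rw [base_eq_hom, coeff_hom]
    split_ifs
    exacts [ht, I.zero_mem]
  rcases eq_bot_or_eq_top J with h | h
  · left
    refine (TwoSidedIdeal.ext fun t => ?_)
    rw [hb, h, TwoSidedIdeal.mem_bot, TwoSidedIdeal.mem_bot]
    refine ⟨fun H => ?_, fun H => by rw [H, base_eq_hom, hom_zero]⟩
    simpa [base_eq_hom] using congrArg (S.coeff 1) H
  · right
    refine (TwoSidedIdeal.ext fun t => ?_)
    rw [hb, h]
    exact ⟨fun _ => trivial, fun _ => trivial⟩

/-- A non-zero central element of a simple ring is right invertible. -/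
theorem exists_mul_eq_one_of_mem_center {R : Type*} [NonAssocRing R] [IsSimpleRing R] {z : R}
    (hz : z ∈ Set.center R) (hz0 : z ≠ 0) : ∃ w, z * w = 1 := by
  let J : TwoSidedIdeal R := TwoSidedIdeal.mk' {x | ∃ w, x = z * w} ⟨0, by simp⟩
    (by rintro _ _ ⟨s, rfl⟩ ⟨t, rfl⟩; exact ⟨s + t, (mul_add _ _ _).symm⟩)
    (by rintro _ ⟨s, rfl⟩; exact ⟨-s, by simp⟩)
    (by
      rintro x _ ⟨s, rfl⟩
      exact ⟨x * s, by rw [(hz.comm s).eq, ← hz.right_assoc, (hz.comm _).eq]⟩)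
    (by rintro _ y ⟨s, rfl⟩; exact ⟨s * y, (hz.left_assoc _ _).symm⟩)
  have hJ : ∀ x, x ∈ J ↔ ∃ w, x = z * w := fun x => by
    simp only [J, TwoSidedIdeal.mem_mk', Set.mem_ofPred_eq]
  have hne : J ≠ ⊥ := by
    intro H
    have : z ∈ J := (hJ z).2 ⟨1, by simp⟩
    rw [H] at this
    exact hz0 ((TwoSidedIdeal.mem_bot R).1 this)
  have h1 : (1 : R) ∈ J := by
    rw [(eq_bot_or_eq_top J).resolve_left hne]
    trivial
  obtain ⟨w, hw⟩ := (hJ 1).1 h1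
  exact ⟨w, hw.symm⟩

theorem not_hasCentralUnit_of_isSimpleRing [Nontrivial T] (hG' : IsTorsionFreeGroup G)
    [IsSimpleRing S.Product] : ¬ S.HasCentralUnit := by
  rintro ⟨u, g, hgc, hg1, H⟩
  set a : T := ((u : nonassocNucleus T) : T) with ha
  set b : T := (((u⁻¹ : (nonassocNucleus T)ˣ) : nonassocNucleus T) : T) with hb
  have hn : a ∈ nonassocNucleus T := Subtype.prop _
  have hab : a * b = 1 := congrArg Subtype.val u.mul_inv
  have hba : b * a = 1 := congrArg Subtype.val u.inv_mul
  have hz : S.hom g a ∈ Set.center S.Product := by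
    refine hom_mem_center hgc hn (fun t => ?_) (fun h => ?_)
    · rw [(H 1 t).2, ← hn.1, ← hn.1, hab, one_mul]
    · rw [(H h 0).1]
      exact S.mul_cocycleInv_mul_val h g (a * S.cocycleVal g h)
  have hz1 : 1 + S.hom g a ∈ Set.center S.Product := Set.add_mem_center Set.one_mem_center hz
  have hz0 : 1 + S.hom g a ≠ 0 := by
    intro h0
    have := congrArg (S.coeff 1) h0
    rw [map_add, coeff_hom_of_ne hg1, one_eq_hom, coeff_hom_same, map_zero, add_zero] at this
    exact one_ne_zero this
  obtain ⟨w, hw⟩ := exists_mul_eq_one_of_mem_center hz1 hz0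
  have hcoef : ∀ k, S.coeff k w + a * S.σ g (S.coeff (g⁻¹ * k) w) * S.cocycleVal g (g⁻¹ * k) =
      S.coeff k 1 := by
    intro k
    rw [← hw, add_mul, one_mul, map_add, coeff_hom_mul]
  have haz : ∀ x, a * x = 0 → x = 0 := fun x hx => by
    rw [← one_mul x, ← hba, hn.2.1, hx, mul_zero]
  have hinj : Function.Injective fun n : ℤ => g ^ n :=
    injective_zpow_iff_not_isOfFinOrder.2 fun h => hg1 (hG' g h)
  -- At `g ^ n` with `n ≠ 0` the right side of `(1 + a u_g) w = 1` vanishes, so neighbouring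
  -- coefficients of `w` vanish together. At `n = 0` the link is broken, hence one chain runs
  -- upwards from `0` and another downwards from `-1`; either would be infinite if nonzero.
  have hstep : ∀ n : ℤ, n ≠ 0 → (S.coeff (g ^ n) w = 0 ↔ S.coeff (g ^ (n - 1)) w = 0) := by
    intro n hn0
    have h1 := hcoef (g ^ n)
    have hgn : (1 : G) ≠ g ^ n := fun h => hn0 (hinj (by simpa using h.symm))
    have hgn' : g⁻¹ * g ^ n = g ^ (n - 1) := by rw [zpow_sub_one, ← zpow_neg_one]; group
    rw [hgn', one_eq_hom, coeff_hom_of_ne hgn] at h1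
    constructor
    · intro h2
      rw [h2, zero_add, S.mul_cocycleVal_eq_zero] at h1
      exact (map_eq_zero_iff _ (S.σ g).injective).1 (haz _ h1)
    · intro h2
      simpa [h2] using h1
  have hpos : S.coeff (g ^ (0 : ℤ)) w = 0 := by
    by_contra h0
    have hall : ∀ n : ℕ, S.coeff (g ^ (n : ℤ)) w ≠ 0 := by
      intro n
      induction n with
      | zero => exact h0
      | succ n ih =>
        rw [Ne, hstep _ (by positivity)]
        simpa using ih
    refine Set.infinite_range_of_injective (f := fun n : ℕ => g ^ (n : ℤ))
      (fun m n h => by simpa using hinj h) ((S.supp w).finite_toSet.subset ?_)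
    rintro _ ⟨n, rfl⟩
    exact mem_supp.2 (hall n)
  have hneg : S.coeff (g ^ (-1 : ℤ)) w = 0 := by
    by_contra h0
    have hall : ∀ n : ℕ, S.coeff (g ^ (-1 - n : ℤ)) w ≠ 0 := by
      intro n
      induction n with
      | zero => simpa using h0
      | succ n ih =>
        have := hstep (-1 - n) (by omega)
        rw [Ne, show (-1 - (n + 1 : ℕ) : ℤ) = -1 - n - 1 by push_cast; ring, ← this]
        exact ih
    refine Set.infinite_range_of_injective (f := fun n : ℕ => g ^ (-1 - n : ℤ))
      (fun m n h => by simpa using hinj h) ((S.supp w).finite_toSet.subset ?_)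
    rintro _ ⟨n, rfl⟩
    exact mem_supp.2 (hall n)
  -- The broken link now reads `0 = 1`.
  have h1 := hcoef 1
  rw [zpow_zero] at hpos
  rw [zpow_neg_one] at hneg
  rw [mul_one, hpos, hneg, one_eq_hom, coeff_hom_same] at h1
  simp at h1

end NonassocCrossedSystem

/-! ### Conjugation-invariant ideals and the passage to central extensions. -/

namespace NonassocCrossedSystem

variable {T G : Type*} [NonAssocRing T] [Group G] {S : NonassocCrossedSystem T G}

/-- The elements of the crossed product supported on a set of degrees. -/
def supportedOn (S : NonassocCrossedSystem T G) (A : Set G) : AddSubgroup S.Product where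
  carrier := {x | ∀ g ∉ A, S.coeff g x = 0}
  add_mem' hx hy g hg := by rw [map_add, hx g hg, hy g hg, add_zero]
  zero_mem' g _ := map_zero _
  neg_mem' hx g hg := by rw [map_neg, hx g hg, neg_zero]

open Classical in
/-- The projection of the crossed product onto the part with degrees in a subgroup. -/
noncomputable def restr (S : NonassocCrossedSystem T G) (N : Subgroup G) :
    S.Product →+ S.Product :=
  Finsupp.filterAddHom (M := T) (· ∈ N)

theorem coeff_restr_of_mem {N : Subgroup G} {g : G} (hg : g ∈ N) (x : S.Product) :
    S.coeff g (S.restr N x) = S.coeff g x := by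
  classical
  exact Finsupp.filter_apply_pos (M := T) (· ∈ N) x hg

theorem coeff_restr_of_notMem {N : Subgroup G} {g : G} (hg : g ∉ N) (x : S.Product) :
    S.coeff g (S.restr N x) = 0 := by
  classical
  exact Finsupp.filter_apply_neg (M := T) (· ∈ N) x hg

theorem restr_base_mul (N : Subgroup G) (t : T) (x : S.Product) :
    S.restr N (S.base t * x) = S.base t * S.restr N x := by
  refine ext_coeff fun g => ?_
  by_cases hg : g ∈ N
  · simp [coeff_restr_of_mem hg, coeff_base_mul]
  · simp [coeff_restr_of_notMem hg, coeff_base_mul]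

theorem restr_mul_base (N : Subgroup G) (t : T) (x : S.Product) :
    S.restr N (x * S.base t) = S.restr N x * S.base t := by
  refine ext_coeff fun g => ?_
  by_cases hg : g ∈ N
  · simp [coeff_restr_of_mem hg, coeff_mul_base]
  · simp [coeff_restr_of_notMem hg, coeff_mul_base]

theorem restr_mul_hom {N : Subgroup G} {n : G} (hn : n ∈ N) (x : S.Product) :
    S.restr N (x * S.hom n 1) = S.restr N x * S.hom n 1 := by
  refine ext_coeff fun g => ?_
  by_cases hg : g ∈ N
  · rw [coeff_restr_of_mem hg, coeff_mul_hom, coeff_mul_hom,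
      coeff_restr_of_mem (N.mul_mem hg (N.inv_mem hn))]
  · rw [coeff_restr_of_notMem hg, coeff_mul_hom, coeff_restr_of_notMem, zero_mul, zero_mul]
    exact fun h => hg (by simpa using N.mul_mem h hn)

/-- The relation `u_h x = y u_h` expresses that `y` is the conjugate of `x` by `u_h`, without
forming an inverse. -/
theorem coeff_conj {h : G} {x y : S.Product} (hxy : S.hom h 1 * x = y * S.hom h 1) (k : G) :
    S.σ h (S.coeff (h⁻¹ * k * h) x) * S.cocycleVal h (h⁻¹ * k * h) =
      S.coeff k y * S.cocycleVal k h := by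
  have := congrArg (S.coeff (k * h)) hxy
  simpa [coeff_mul_hom, coeff_hom_mul, mul_assoc] using this

theorem coeff_conj_eq_zero {h : G} {x y : S.Product} (hxy : S.hom h 1 * x = y * S.hom h 1)
    {k : G} (hk : S.coeff (h⁻¹ * k * h) x = 0) : S.coeff k y = 0 := by
  have := coeff_conj hxy k
  rw [hk, map_zero, zero_mul] at this
  exact S.mul_cocycleVal_eq_zero.1 this.symm

theorem eq_of_mul_hom_one_eq {h : G} {x y : S.Product} (H : x * S.hom h 1 = y * S.hom h 1) :
    x = y := by
  refine ext_coeff fun k => ?_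
  have := congrArg (S.coeff (k * h)) H
  simpa [coeff_mul_hom, S.mul_cocycleVal_inj] using this

theorem restr_conj {N : Subgroup G} [hN : N.Normal] {h : G} {x y : S.Product}
    (hxy : S.hom h 1 * x = y * S.hom h 1) :
    S.hom h 1 * S.restr N x = S.restr N y * S.hom h 1 := by
  refine ext_coeff fun g => ?_
  have := congrArg (S.coeff g) hxy
  rw [coeff_mul_hom, coeff_hom_mul] at this ⊢
  have hiff : h⁻¹ * g ∈ N ↔ g * h⁻¹ ∈ N := hN.mem_comm_iff
  by_cases hg : g * h⁻¹ ∈ N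
  · rw [coeff_restr_of_mem hg, coeff_restr_of_mem (hiff.2 hg), this]
  · rw [coeff_restr_of_notMem hg, coeff_restr_of_notMem (fun h => hg (hiff.1 h))]
    simp

theorem base_mul_mem_supportedOn {A : Set G} {x : S.Product} (hx : x ∈ S.supportedOn A) (t : T) :
    S.base t * x ∈ S.supportedOn A := fun g hg => by
  rw [coeff_base_mul, hx g hg, mul_zero]

theorem mul_base_mem_supportedOn {A : Set G} {x : S.Product} (hx : x ∈ S.supportedOn A) (t : T) :
    x * S.base t ∈ S.supportedOn A := fun g hg => by
  rw [coeff_mul_base, hx g hg, zero_mul]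

theorem mul_hom_mem_supportedOn {A : Set G} {n : G} (hn : ∀ g, g * n⁻¹ ∈ A → g ∈ A)
    {x : S.Product} (hx : x ∈ S.supportedOn A) : x * S.hom n 1 ∈ S.supportedOn A := fun g hg => by
  rw [coeff_mul_hom, hx _ fun h => hg (hn g h), zero_mul, zero_mul]

theorem conj_mem_supportedOn {A : Set G} {h : G} (hA : ∀ g, h⁻¹ * g * h ∈ A → g ∈ A)
    {x y : S.Product} (hx : x ∈ S.supportedOn A) (hxy : S.hom h 1 * x = y * S.hom h 1) :
    y ∈ S.supportedOn A := fun g hg =>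
  coeff_conj_eq_zero hxy (hx _ fun H => hg (hA g H))

/-- An additive subgroup of the part of the crossed product with degrees in `N` that is an ideal
of this part and is invariant under conjugation by all `u_h`. -/
structure IsConjIdeal (N : Subgroup G) (J : AddSubgroup S.Product) : Prop where
  le_supportedOn : J ≤ S.supportedOn N
  base_mul : ∀ x ∈ J, ∀ t, S.base t * x ∈ J
  mul_base : ∀ x ∈ J, ∀ t, x * S.base t ∈ J
  mul_hom : ∀ x ∈ J, ∀ n ∈ N, x * S.hom n 1 ∈ J
  conj : ∀ x ∈ J, ∀ h, ∃ y ∈ J, S.hom h 1 * x = y * S.hom h 1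

theorem IsConjIdeal.inf_supportedOn {N M : Subgroup G} [hN : N.Normal] (hNM : N ≤ M)
    {J : AddSubgroup S.Product} (hJ : IsConjIdeal M J) : IsConjIdeal N (J ⊓ S.supportedOn N) where
  le_supportedOn := inf_le_right
  base_mul x hx t := ⟨hJ.base_mul x hx.1 t, base_mul_mem_supportedOn hx.2 t⟩
  mul_base x hx t := ⟨hJ.mul_base x hx.1 t, mul_base_mem_supportedOn hx.2 t⟩
  mul_hom x hx n hn := ⟨hJ.mul_hom x hx.1 n (hNM hn), mul_hom_mem_supportedOn
    (fun g hg => by simpa using N.mul_mem hg hn) hx.2⟩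
  conj x hx h := by
    obtain ⟨y, hy, hxy⟩ := hJ.conj x hx.1 h
    refine ⟨y, ⟨hy, conj_mem_supportedOn (fun g hg => ?_) hx.2 hxy⟩, hxy⟩
    simpa [mul_assoc] using hN.conj_mem _ hg h

/-- In degree `1` such a `J` is an ideal of `T`, on which conjugation by `u_h` acts as `σ h`. -/
theorem IsGSimple.one_mem_of_isConjIdeal_bot (hS : S.IsGSimple) {J : AddSubgroup S.Product}
    (hJ : IsConjIdeal ⊥ J) (hJ0 : J ≠ ⊥) : (1 : S.Product) ∈ J := by
  have hb : ∀ x ∈ J, x = S.base (S.coeff 1 x) := fun x hx => ext_coeff fun g => by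
    by_cases hg : g = 1
    · subst hg
      simp [base_eq_hom]
    · rw [base_eq_hom, coeff_hom_of_ne (Ne.symm hg)]
      exact hJ.le_supportedOn hx g (by simpa using hg)
  have base_add : ∀ s t, S.base (s + t) = S.base s + S.base t := hom_add 1
  have base_zero : S.base 0 = 0 := hom_zero 1
  let I : TwoSidedIdeal T := TwoSidedIdeal.mk' {t | S.base t ∈ J}
    (by simp [base_zero, J.zero_mem])
    (fun {s t} hs ht => by simpa [base_add] using J.add_mem hs ht)
    (fun {s} hs => by
      have h0 : S.base (-s) = -S.base s := by
        rw [eq_neg_iff_add_eq_zero, ← base_add, neg_add_cancel, base_zero]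
      simpa [h0] using hs)
    (fun {s t} ht => by simpa [base_mul_base] using hJ.base_mul _ ht s)
    (fun {s t} hs => by simpa [base_mul_base] using hJ.mul_base _ hs t)
  have hI : ∀ t, t ∈ I ↔ S.base t ∈ J := fun x => by
    simp only [I, TwoSidedIdeal.mem_mk', Set.mem_ofPred_eq]
  have hinv : S.IsInvariant I := by
    intro h t ht
    rw [hI] at ht ⊢
    obtain ⟨y, hy, hxy⟩ := hJ.conj _ ht h
    have h2 : y * S.hom h 1 = S.base (S.σ h t) * S.hom h 1 := by
      rw [← hxy]
      simp [base_eq_hom, hom_mul_hom]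
    rwa [← eq_of_mul_hom_one_eq h2]
  have hne : I ≠ ⊥ := by
    intro H
    refine hJ0 ((AddSubgroup.eq_bot_iff_forall J).2 fun x hx => ?_)
    have : S.coeff 1 x ∈ I := (hI _).2 (by rwa [← hb x hx])
    rw [H, TwoSidedIdeal.mem_bot] at this
    rw [hb x hx, this, base_zero]
  have h1 : (1 : T) ∈ I := by
    rw [(hS I hinv).resolve_left hne]
    trivial
  exact (hI 1).1 h1

open Classical in
/-- The cosets modulo `N` met by the support. -/
noncomputable def cosets (N : Subgroup G) (x : S.Product) : Finset (G ⧸ N) :=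
  (S.supp x).image (fun g => (g : G ⧸ N))

theorem mem_cosets {N : Subgroup G} {x : S.Product} {q : G ⧸ N} :
    q ∈ cosets N x ↔ ∃ g, S.coeff g x ≠ 0 ∧ (g : G ⧸ N) = q := by
  simp [cosets, mem_supp]

/-- Right multiplication by `u_{m⁻¹}` moves a nonzero coefficient from `m` to `1` and only
translates the cosets met. -/
theorem IsConjIdeal.exists_coeff_one_ne_zero {N M : Subgroup G} [N.Normal]
    {J : AddSubgroup S.Product} (hJ : IsConjIdeal M J) {z : S.Product} (hz : z ∈ J)
    (hz0 : z ≠ 0) :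
    ∃ y ∈ J, S.coeff 1 y ≠ 0 ∧ (cosets N y).card ≤ (cosets N z).card := by
  classical
  obtain ⟨m, hm⟩ : ∃ m, S.coeff m z ≠ 0 := by
    by_contra! H
    exact hz0 (ext_coeff fun g => by rw [H, map_zero])
  have hmM : m ∈ M := by
    by_contra H
    exact hm (hJ.le_supportedOn hz m H)
  refine ⟨z * S.hom m⁻¹ 1, hJ.mul_hom z hz _ (M.inv_mem hmM), ?_, ?_⟩
  · rw [coeff_mul_hom, Ne, S.mul_cocycleVal_eq_zero]
    simpa using hm
  · refine (Finset.card_le_card (t := (cosets N z).image (· * (m⁻¹ : G ⧸ N))) ?_).trans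
      Finset.card_image_le
    intro q hq
    obtain ⟨g, hg, rfl⟩ := mem_cosets.1 hq
    refine Finset.mem_image.2 ⟨((g * m : G) : G ⧸ N), mem_cosets.2 ⟨g * m, ?_, rfl⟩, by simp⟩
    intro H
    exact hg (by rw [coeff_mul_hom]; simp [H])

/-- If the conjugation invariant ideals in degrees `N` are trivial, then so are those in
degrees `M`, for a central extension `M` of `N`. -/
theorem IsConjIdeal.one_mem_of_central_extension (hc : Set.center S.Product ⊆ Set.range S.base)
    {N M : Subgroup G} [hN : N.Normal] [hM : M.Normal] (hNM : N ≤ M)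
    (hcomm : ∀ m ∈ M, ∀ g : G, g * m * g⁻¹ * m⁻¹ ∈ N)
    (ih : ∀ J : AddSubgroup S.Product, IsConjIdeal N J → J ≠ ⊥ → (1 : S.Product) ∈ J)
    {J : AddSubgroup S.Product} (hJ : IsConjIdeal M J) (hJ0 : J ≠ ⊥) : (1 : S.Product) ∈ J := by
  obtain ⟨z, hz0⟩ := AddSubgroup.ne_bot_iff_exists_ne_zero.1 hJ0
  obtain ⟨z', hz', hz'1, -⟩ := hJ.exists_coeff_one_ne_zero (N := N) z.2
    fun h => hz0 (Subtype.ext h)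
  obtain ⟨x, ⟨hx, hx1⟩, hmin⟩ := WellFounded.has_min
    (measure fun x : S.Product => (cosets N x).card).wf
    {x | x ∈ J ∧ S.coeff 1 x ≠ 0} ⟨z', hz', hz'1⟩
  -- All further work takes place in these cosets: `A` is stable under right translation by `N`, and
  -- under conjugation because `M/N` is central in `G/N`.
  set A : Set G := {g | g ∈ M ∧ (g : G ⧸ N) ∈ cosets N x} with hA
  have hxA : x ∈ S.supportedOn A := by
    intro g hg
    by_contra h
    refine hg ⟨?_, mem_cosets.2 ⟨g, h, rfl⟩⟩
    by_contra H
    exact h (hJ.le_supportedOn hx g H)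
  have hAconj : ∀ h g, h⁻¹ * g * h ∈ A → g ∈ A := by
    rintro h g ⟨hgM, hgK⟩
    have hg : g ∈ M := by simpa [mul_assoc] using hM.conj_mem _ hgM h
    refine ⟨hg, ?_⟩
    have := hcomm g hg h⁻¹
    rw [inv_inv, ← QuotientGroup.eq_one_iff, QuotientGroup.mk_mul, QuotientGroup.mk_inv,
      mul_inv_eq_one] at this
    rwa [← this]
  have hAmul : ∀ n ∈ N, ∀ g, g * n⁻¹ ∈ A → g ∈ A := by
    rintro n hn g ⟨hgM, hgK⟩
    refine ⟨by simpa using M.mul_mem hgM (hNM hn), ?_⟩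
    rwa [QuotientGroup.mk_mul, QuotientGroup.mk_inv, (QuotientGroup.eq_one_iff n).2 hn,
      inv_one, mul_one] at hgK
  -- Such a `z` misses the coset `N`, which `x` meets. If nonzero, its translate with a nonzero
  -- coefficient at `1` would meet fewer cosets than `x`.
  have vanish : ∀ z ∈ J ⊓ S.supportedOn A, S.restr N z = 0 → z = 0 := by
    rintro z ⟨hz, hzA⟩ hr
    by_contra hz0
    obtain ⟨y, hy, hy1, hcard⟩ := hJ.exists_coeff_one_ne_zero (N := N) hz hz0
    refine hmin y ⟨hy, hy1⟩ (hcard.trans_lt (Finset.card_lt_card ?_))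
    refine Finset.ssubset_iff_subset_ne.2 ⟨fun q hq => ?_, fun H => ?_⟩
    · obtain ⟨g, hg, rfl⟩ := mem_cosets.1 hq
      by_contra hgx
      exact hg (hzA g fun h => hgx h.2)
    · have h1 : (1 : G ⧸ N) ∈ cosets N x := mem_cosets.2 ⟨1, hx1, rfl⟩
      rw [← H] at h1
      obtain ⟨g, hg, hg1⟩ := mem_cosets.1 h1
      rw [← coeff_restr_of_mem ((QuotientGroup.eq_one_iff g).1 hg1), hr, map_zero] at hg
      exact hg rfl
  have hJ' : IsConjIdeal N ((J ⊓ S.supportedOn A).map (S.restr N)) := by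
    refine ⟨?_, ?_, ?_, ?_, ?_⟩
    · rintro _ ⟨y, -, rfl⟩ g hg
      exact coeff_restr_of_notMem hg y
    · rintro _ ⟨y, hy, rfl⟩ t
      exact ⟨S.base t * y, ⟨hJ.base_mul y hy.1 t, base_mul_mem_supportedOn hy.2 t⟩,
        restr_base_mul N t y⟩
    · rintro _ ⟨y, hy, rfl⟩ t
      exact ⟨y * S.base t, ⟨hJ.mul_base y hy.1 t, mul_base_mem_supportedOn hy.2 t⟩,
        restr_mul_base N t y⟩
    · rintro _ ⟨y, hy, rfl⟩ n hn
      exact ⟨y * S.hom n 1, ⟨hJ.mul_hom y hy.1 n (hNM hn),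
        mul_hom_mem_supportedOn (hAmul n hn) hy.2⟩, restr_mul_hom hn y⟩
    · rintro _ ⟨y, hy, rfl⟩ h
      obtain ⟨y', hy', hyy⟩ := hJ.conj y hy.1 h
      exact ⟨_, ⟨y', ⟨hy', conj_mem_supportedOn (hAconj h) hy.2 hyy⟩, rfl⟩, restr_conj hyy⟩
  have hJ'0 : (J ⊓ S.supportedOn A).map (S.restr N) ≠ ⊥ := by
    intro H
    have : S.restr N x ∈ (J ⊓ S.supportedOn A).map (S.restr N) := ⟨x, ⟨hx, hxA⟩, rfl⟩
    rw [H, AddSubgroup.mem_bot] at this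
    rw [← coeff_restr_of_mem N.one_mem, this, map_zero] at hx1
    exact hx1 rfl
  obtain ⟨y, hy, hy1⟩ := ih _ hJ' hJ'0
  have hbm : ∀ z ∈ J ⊓ S.supportedOn A, ∀ t, S.base t * z ∈ J ⊓ S.supportedOn A :=
    fun z hz t => ⟨hJ.base_mul z hz.1 t, base_mul_mem_supportedOn hz.2 t⟩
  have hmb : ∀ z ∈ J ⊓ S.supportedOn A, ∀ t, z * S.base t ∈ J ⊓ S.supportedOn A :=
    fun z hz t => ⟨hJ.mul_base z hz.1 t, mul_base_mem_supportedOn hz.2 t⟩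
  have heq : ∀ z ∈ J ⊓ S.supportedOn A, ∀ w ∈ J ⊓ S.supportedOn A,
      S.restr N z = S.restr N w → z = w := fun z hz w hw h =>
    sub_eq_zero.1 (vanish _ (AddSubgroup.sub_mem _ hz hw) (by rw [map_sub, h, sub_self]))
  -- Both sides of each identity lie in `J`, are supported on `A`, and have the same part in `N`
  -- because that part of `y` is `1`; so `heq` identifies them.
  have hyc : y ∈ Set.center S.Product := by
    refine mem_center_of_base (fun t => ?_) (fun h => ?_) (fun s t => ?_) (fun s t => ?_)
    · exact heq _ (hmb y hy t) _ (hbm y hy t) (by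
        rw [restr_mul_base, restr_base_mul, hy1, one_mul, mul_one])
    · obtain ⟨y', hy', hyy⟩ := hJ.conj y hy.1 h
      have h1 := restr_conj (N := N) hyy
      rw [hy1, mul_one] at h1
      have h2 : S.restr N y' = 1 := eq_of_mul_hom_one_eq (h := h) (by rw [← h1, one_mul])
      rw [hyy, heq y hy y' ⟨hy', conj_mem_supportedOn (hAconj h) hy.2 hyy⟩ (by rw [hy1, h2])]
    · rw [base_mul_base]
      exact heq _ (hmb y hy _) _ (hmb _ (hmb y hy s) t) (by
        simp only [restr_mul_base, hy1, one_mul, base_mul_base])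
    · rw [base_mul_base]
      exact heq _ (hbm y hy _) _ (hbm _ (hbm y hy t) s) (by
        simp only [restr_base_mul, hy1, mul_one, base_mul_base])
  obtain ⟨t, rfl⟩ := hc hyc
  have h1 : S.base t = 1 := by
    rw [← hy1]
    refine ext_coeff fun g => ?_
    by_cases hg : g ∈ N
    · rw [coeff_restr_of_mem hg]
    · rw [coeff_restr_of_notMem hg, base_eq_hom, coeff_hom_of_ne]
      rintro rfl
      exact hg N.one_mem
  rw [← h1]
  exact hy.1

theorem isSimpleRing_of_center_subset [Nontrivial T] (hG : IsHypercentralGroup G)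
    (hS : S.IsGSimple) (hc : Set.center S.Product ⊆ Set.range S.base) :
    IsSimpleRing S.Product := by
  have key : ∀ J : AddSubgroup S.Product, IsConjIdeal ⊤ J → J ≠ ⊥ → (1 : S.Product) ∈ J := by
    refine hG.normal_induction
      (fun N => ∀ J : AddSubgroup S.Product, IsConjIdeal N J → J ≠ ⊥ → (1 : S.Product) ∈ J)
      (fun J hJ hJ0 => hS.one_mem_of_isConjIdeal_bot hJ hJ0) ?_ ?_
    · intro c hne hchain hcP J hJ hJ0
      obtain ⟨x, hx⟩ := AddSubgroup.ne_bot_iff_exists_ne_zero.1 hJ0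
      -- A finite support lies in a single member of the chain.
      obtain ⟨N, hN, hxN⟩ := DirectedOn.exists_mem_subset_of_finset_subset_biUnion
        (f := fun N : Subgroup G => (N : Set G)) (s := S.supp (x : S.Product)) hne
        hchain.directedOn (by
          intro g hg
          have hg' : g ∈ sSup c := by
            by_contra H
            exact mem_supp.1 hg (hJ.le_supportedOn x.2 g H)
          obtain ⟨N, hN, hg'⟩ := (Subgroup.mem_sSup_of_directedOn hne hchain.directedOn).1 hg'
          exact Set.mem_biUnion hN hg')
      have := (hcP N hN).1
      refine ((hcP N hN).2 _ (hJ.inf_supportedOn (le_sSup hN)) fun H => hx (Subtype.ext ?_)).1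
      have hmem : (x : S.Product) ∈ J ⊓ S.supportedOn N := by
        refine ⟨x.2, fun g hg => ?_⟩
        by_contra h
        exact hg (hxN (mem_supp.2 h))
      rwa [H, AddSubgroup.mem_bot] at hmem
    · intro N M hN hM hNM hcomm ih J hJ hJ0
      exact hJ.one_mem_of_central_extension hc hNM hcomm ih hJ0
  have h10 : (1 : S.Product) ≠ 0 := by
    intro h
    have := congrArg (S.coeff 1) h
    rw [one_eq_hom, coeff_hom_same, map_zero] at this
    exact one_ne_zero this
  have hnt : Nontrivial (TwoSidedIdeal S.Product) := ⟨⊥, ⊤, fun h => h10 (by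
    have : (1 : S.Product) ∈ (⊤ : TwoSidedIdeal S.Product) := trivial
    rwa [← h, TwoSidedIdeal.mem_bot] at this)⟩
  refine ⟨⟨fun I => ?_⟩⟩
  by_cases hI : I = ⊥
  · exact Or.inl hI
  right
  let J : AddSubgroup S.Product :=
    { carrier := {x | x ∈ I}
      add_mem' := fun hx hy => I.add_mem hx hy
      zero_mem' := I.zero_mem
      neg_mem' := fun hx => I.neg_mem hx }
  have h1 : (1 : S.Product) ∈ J := by
    refine key J ⟨fun x _ g hg => absurd trivial hg, fun x hx t => I.mul_mem_left _ _ hx,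
      fun x hx t => I.mul_mem_right _ _ hx, fun x hx n _ => I.mul_mem_right _ _ hx,
      fun x hx h => ?_⟩ fun H => hI (TwoSidedIdeal.ext fun x => ?_)
    -- The conjugate uses a left inverse of `u_h`; nuclearity of `u_h` lets it cancel.
    · refine ⟨S.hom h 1 * x * S.hom h⁻¹ (S.cocycleInv h⁻¹ h),
        I.mul_mem_right _ _ (I.mul_mem_left _ _ hx), ?_⟩
      rw [mul_mul_hom_one, hom_inv_mul_hom_one, mul_one]
    · have : x ∈ I ↔ x ∈ J := Iff.rfl
      rw [this, H, AddSubgroup.mem_bot, TwoSidedIdeal.mem_bot]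
  refine TwoSidedIdeal.ext fun x => ⟨fun _ => trivial, fun _ => ?_⟩
  rw [← mul_one x]
  exact I.mul_mem_left _ _ h1

end NonassocCrossedSystem

theorem mainTheorem3 {T G : Type*} [NonAssocRing T] [Nontrivial T] [Group G]
    (hG : IsHypercentralGroup G) (hG' : IsTorsionFreeGroup G)
    (S : NonassocCrossedSystem T G) :
    List.TFAE [
      IsSimpleRing S.Product,
      S.IsGSimple ∧ Set.center S.Product = S.base '' S.fixedCenter,
      S.IsGSimple ∧
        ¬ ∃ (u : (nonassocNucleus T)ˣ) (g : G), g ∈ Subgroup.center G ∧ g ≠ 1 ∧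
          ∀ (h : G) (t : T),
            S.σ h ((u : nonassocNucleus T) : T) =
              ((u * S.α g h * (S.α h g)⁻¹ : (nonassocNucleus T)ˣ) : nonassocNucleus T) ∧
            S.σ g t = (((u⁻¹ : (nonassocNucleus T)ˣ) : nonassocNucleus T) : T) * t *
              ((u : nonassocNucleus T) : T)] := by
  tfae_have 1 → 3 := fun h =>
    ⟨NonassocCrossedSystem.isGSimple_of_isSimpleRing,
      NonassocCrossedSystem.not_hasCentralUnit_of_isSimpleRing hG'⟩
  tfae_have 3 → 2 := fun h =>
    ⟨h.1, NonassocCrossedSystem.center_eq_base_image hG hG' h.1 h.2⟩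
  tfae_have 2 → 1 := fun h =>
    NonassocCrossedSystem.isSimpleRing_of_center_subset hG h.1
      (h.2.subset.trans (Set.image_subset_range _ _))
  tfae_finish
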